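/- Let $B_j$ be the Bernoulli numbers, defined by $\frac{z}{e^z-1}=\sum_{j\ge 0}B_j\frac{z^j}{j!}$, and for $n\ge 0$ and $x>0$ put $$R_n(x)=(-1)^n\Big[\log\Gamma(x)-\big(x-\tfrac12\big)\log x+x-\tfrac12\log(2\pi)-\sum_{k=1}^{n}\frac{B_{2k}}{2k(2k-1)}\,\frac{1}{x^{2k-1}}\Big].$$ A function $f$ is completely monotonic on $(0,\infty)$ if it has derivatives of all orders there and $(-1)^kf^{(k)}(x)\ge 0$ for all $x>0$ and all integers $k\ge 0$. If $f$ is completely monotonic on $(0,\infty)$, with $f(+\infty)=\lim_{x\to+\infty}f(x)$, then a real number $\alpha\ge 0$ is called the completely monotonic degree of $f$, written $\deg_{cm}(f)$, if for every real $r\ge 0$ the function $x^r\,[f(x)-f(+\infty)]$ is completely monotonic on $(0,\infty)$ if and only if $r\le\alpha$. For every integer $n\ge 2$, the function $R_n$ is completely monotonic on $(0,\infty)$, its completely monotonic degree exists, and $$2(n-1)\le \deg_{cm}(R_n)<2n-1.$$ -/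

import Mathlib

open Set Filter Topology
open scoped ContDiff

/-- `f` is completely monotonic on `I`: it has derivatives of all orders on `I`, and
`(-1) ^ k * f⁽ᵏ⁾(x) ≥ 0` for all `x ∈ I` and all `k ≥ 0`. -/
def CompletelyMonotonicOn (f : ℝ → ℝ) (I : Set ℝ) : Prop :=
  ContDiffOn ℝ ∞ f I ∧ ∀ k : ℕ, ∀ x ∈ I, 0 ≤ (-1 : ℝ) ^ k * iteratedDerivWithin k f I x

/-- `α` is the completely monotonic degree of `f` on `(0, ∞)`: `f` is completely monotonic there,
it has a limit `L` at `+∞`, and for real `r ≥ 0` the function `x ^ r * (f x - L)` is completely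
monotonic on `(0, ∞)` if and only if `r ≤ α`. -/
def IsCMDegree (f : ℝ → ℝ) (α : ℝ) : Prop :=
  CompletelyMonotonicOn f (Ioi 0) ∧ 0 ≤ α ∧
    ∃ L : ℝ, Tendsto f atTop (𝓝 L) ∧
      ∀ r : ℝ, 0 ≤ r →
        (CompletelyMonotonicOn (fun x => x ^ r * (f x - L)) (Ioi 0) ↔ r ≤ α)

/-- The completely monotonic degree is unique when it exists. -/
theorem IsCMDegree.unique {f : ℝ → ℝ} {α β : ℝ} (hα : IsCMDegree f α) (hβ : IsCMDegree f β) :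
    α = β := by
  obtain ⟨-, hα0, L, hL, h⟩ := hα
  obtain ⟨-, hβ0, M, hM, h'⟩ := hβ
  obtain rfl := tendsto_nhds_unique hL hM
  exact le_antisymm ((h' α hα0).1 ((h α hα0).2 le_rfl)) ((h β hβ0).1 ((h' β hβ0).2 le_rfl))

/-- The signed remainder `R_n` of the asymptotic expansion of `log Γ(x)`. -/
noncomputable def logGammaRemainder (n : ℕ) (x : ℝ) : ℝ :=
  (-1 : ℝ) ^ n *
    (Real.log (Real.Gamma x) - (x - 1 / 2) * Real.log x + x - 1 / 2 * Real.log (2 * Real.pi)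
      - ∑ k ∈ Finset.Icc 1 n,
          (bernoulli (2 * k) : ℝ) / (2 * (k : ℝ) * (2 * (k : ℝ) - 1)) * (1 / x ^ (2 * k - 1)))

/-! Write a_k = 2π(k+1) and let L be the Laplace transform. Binet's formula
(`hasSum_logGammaRemainder_zero`) reads R_0(x) = Σ_k (2/a_k) L[1/(1+s²)](a_k x): both sides have the
same difference f(x) - f(x+1) and tend to 0 along x + m.

Integrating by parts 2p times splits off the Bernoulli terms. Absorbing one further term into the
integral gives x^(2p) R_{p+1} = L[q] with q bounded and positive (`pow_mul_logGammaRemainder_succ`),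
because 1/(1+s²) = Im 1/(s-i) has m-th derivative at most m! in absolute value. Hence x^(2p) R_{p+1}
is completely monotonic, which for p = n-1 is the lower bound.

For the upper bound, x^(2n-1) R_n = c - x^(2n-1) R_{n-1}. If n ≥ 2, the estimate L[q](x) ≤ C/x makes
the subtracted function positive and O(x²), so it is not concave (`not_convexOn_const_sub`), while a
completely monotonic function is convex.

The degree exists because the admissible exponents form a closed, downward closed set
(`exists_isCMDegree`). -/

open MeasureTheory
open scoped Nat

/-! ### Derivatives of 1/(1+s²) -/

/-- The `m`-th derivative of `1 / (1 + s ^ 2)`, written as an imaginary part. -/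
noncomputable def poissonKernelDeriv (m : ℕ) (s : ℝ) : ℝ :=
  (-1) ^ m * (m ! : ℝ) * ((((s : ℂ) - Complex.I)⁻¹) ^ (m + 1)).im

/-- The Laplace transform of `f` at `y`. -/
noncomputable def laplace (f : ℝ → ℝ) (y : ℝ) : ℝ :=
  ∫ t in Ioi (0 : ℝ), Real.exp (-(y * t)) * f t

lemma ofReal_sub_I_ne_zero (s : ℝ) : (s : ℂ) - Complex.I ≠ 0 := fun h => by
  have := congrArg Complex.im h
  simp at this

lemma normSq_ofReal_sub_I (s : ℝ) : Complex.normSq ((s : ℂ) - Complex.I) = 1 + s ^ 2 := by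
  simp [Complex.normSq_apply]; ring

lemma poissonKernelDeriv_zero (s : ℝ) : poissonKernelDeriv 0 s = 1 / (1 + s ^ 2) := by
  simp only [poissonKernelDeriv, pow_zero, Nat.factorial_zero, Nat.cast_one, mul_one, zero_add,
    pow_one, Complex.inv_im, normSq_ofReal_sub_I]
  simp

lemma hasDerivAt_poissonKernelDeriv (m : ℕ) (s : ℝ) :
    HasDerivAt (poissonKernelDeriv m) (poissonKernelDeriv (m + 1) s) s := by
  have hs := ofReal_sub_I_ne_zero s
  have h1 : HasDerivAt (fun z : ℂ => ((z - Complex.I)⁻¹) ^ (m + 1))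
      (-((m + 1 : ℕ) : ℂ) * (((s : ℂ) - Complex.I)⁻¹) ^ (m + 2)) (s : ℂ) := by
    have := ((((hasDerivAt_id (s : ℂ)).sub_const Complex.I).inv hs).pow (m + 1))
    convert! this using 1
    simp only [id, Nat.add_sub_cancel, Pi.inv_apply]
    rw [neg_div, one_div, ← inv_pow]
    ring
  have h2 := Complex.imCLM.hasFDerivAt.comp_hasDerivAt s h1.comp_ofReal
  have h3 := h2.const_mul ((-1 : ℝ) ^ m * (m ! : ℝ))
  convert! h3 using 1
  have : (-((m + 1 : ℕ) : ℂ) * (((s : ℂ) - Complex.I)⁻¹) ^ (m + 2)).im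
      = -((m + 1 : ℕ) : ℝ) * ((((s : ℂ) - Complex.I)⁻¹) ^ (m + 2)).im := by
    rw [← Complex.ofReal_natCast, ← Complex.ofReal_neg, Complex.im_ofReal_mul]
  rw [Complex.imCLM_apply, this, poissonKernelDeriv, Nat.factorial_succ]
  push_cast
  ring

lemma continuous_poissonKernelDeriv (m : ℕ) : Continuous (poissonKernelDeriv m) :=
  continuous_iff_continuousAt.2 fun s => (hasDerivAt_poissonKernelDeriv m s).continuousAt

lemma norm_inv_ofReal_sub_I_sq (s : ℝ) : ‖((s : ℂ) - Complex.I)⁻¹‖ ^ 2 = (1 + s ^ 2)⁻¹ := by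
  rw [norm_inv, inv_pow, ← Complex.normSq_eq_norm_sq, normSq_ofReal_sub_I]

lemma abs_poissonKernelDeriv_le_norm (m : ℕ) (s : ℝ) :
    |poissonKernelDeriv m s| ≤ (m ! : ℝ) * ‖((s : ℂ) - Complex.I)⁻¹‖ ^ (m + 1) := by
  rw [poissonKernelDeriv, abs_mul, abs_mul, abs_pow, abs_neg, abs_one, one_pow, one_mul,
    Nat.abs_cast, ← norm_pow]
  gcongr
  exact Complex.abs_im_le_norm _

lemma abs_poissonKernelDeriv_le (m : ℕ) (s : ℝ) : |poissonKernelDeriv m s| ≤ (m ! : ℝ) := by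
  refine (abs_poissonKernelDeriv_le_norm m s).trans (mul_le_of_le_one_right (by positivity) ?_)
  refine pow_le_one₀ (norm_nonneg _) ?_
  rw [← sq_le_one_iff₀ (norm_nonneg _), norm_inv_ofReal_sub_I_sq]
  exact inv_le_one_of_one_le₀ (by nlinarith [sq_nonneg s])

/-- Strictness away from the origin is what makes the remainder density positive. -/
lemma abs_poissonKernelDeriv_lt (m : ℕ) {s : ℝ} (hs : 0 < s) :
    |poissonKernelDeriv m s| < (m ! : ℝ) := by
  refine (abs_poissonKernelDeriv_le_norm m s).trans_lt (mul_lt_of_lt_one_right (by positivity) ?_)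
  refine pow_lt_one₀ (norm_nonneg _) ?_ (Nat.succ_ne_zero m)
  rw [← sq_lt_one_iff₀ (norm_nonneg _), norm_inv_ofReal_sub_I_sq]
  exact inv_lt_one_of_one_lt₀ (by nlinarith [sq_pos_of_pos hs])

lemma poissonKernelDeriv_even_apply_zero (p : ℕ) :
    poissonKernelDeriv (2 * p) 0 = (-1) ^ p * ((2 * p)! : ℝ) := by
  have : (((((0 : ℝ) : ℂ) - Complex.I)⁻¹) ^ (2 * p + 1)) = (((-1) ^ p : ℝ) : ℂ) * Complex.I := by
    rw [pow_succ, pow_mul]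
    simp
  rw [poissonKernelDeriv, this, Complex.im_ofReal_mul]
  simp
  ring

lemma poissonKernelDeriv_odd_apply_zero (p : ℕ) : poissonKernelDeriv (2 * p + 1) 0 = 0 := by
  have : (((((0 : ℝ) : ℂ) - Complex.I)⁻¹) ^ (2 * p + 1 + 1)) = (((-1) ^ (p + 1) : ℝ) : ℂ) := by
    rw [show 2 * p + 1 + 1 = 2 * (p + 1) by ring, pow_mul]
    simp
  rw [poissonKernelDeriv, this, Complex.ofReal_im, mul_zero]

/-! ### Laplace transforms of bounded functions -/

lemma integrableOn_exp_neg_mul_Ioi {y : ℝ} (hy : 0 < y) :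
    IntegrableOn (fun t => Real.exp (-(y * t))) (Ioi 0) := by
  simpa [neg_mul] using exp_neg_integrableOn_Ioi 0 hy

lemma integral_exp_neg_mul_Ioi_zero {y : ℝ} (hy : 0 < y) :
    ∫ t in Ioi (0 : ℝ), Real.exp (-(y * t)) = 1 / y := by
  have := integral_exp_mul_Ioi (a := -y) (by linarith) 0
  simpa [neg_mul, neg_div, div_neg] using this

lemma integrableOn_exp_neg_mul_of_bound {f : ℝ → ℝ} {C y : ℝ} (hf : Measurable f)
    (hC : ∀ t ∈ Ioi (0 : ℝ), |f t| ≤ C) (hy : 0 < y) :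
    IntegrableOn (fun t => Real.exp (-(y * t)) * f t) (Ioi 0) := by
  refine (integrableOn_exp_neg_mul_Ioi hy).mul_bdd (c := C) hf.aestronglyMeasurable ?_
  exact (ae_restrict_iff' measurableSet_Ioi).2 (ae_of_all _ hC)

lemma laplace_le_of_bound {f : ℝ → ℝ} {C y : ℝ} (hf : Measurable f)
    (hC : ∀ t ∈ Ioi (0 : ℝ), |f t| ≤ C) (hy : 0 < y) : laplace f y ≤ C / y := by
  have : ∫ t in Ioi (0 : ℝ), Real.exp (-(y * t)) * C = C / y := by
    rw [integral_mul_const, integral_exp_neg_mul_Ioi_zero hy]; ring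
  rw [← this]
  refine setIntegral_mono_on (integrableOn_exp_neg_mul_of_bound hf hC hy)
    ((integrableOn_exp_neg_mul_Ioi hy).mul_const C) measurableSet_Ioi fun t ht => ?_
  gcongr
  exact (le_abs_self _).trans (hC t ht)

lemma laplace_nonneg {f : ℝ → ℝ} {y : ℝ} (hf : ∀ t ∈ Ioi (0 : ℝ), 0 ≤ f t) : 0 ≤ laplace f y :=
  setIntegral_nonneg measurableSet_Ioi fun t ht => mul_nonneg (Real.exp_pos _).le (hf t ht)

lemma laplace_pos {f : ℝ → ℝ} {C y : ℝ} (hf : Measurable f)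
    (hC : ∀ t ∈ Ioi (0 : ℝ), |f t| ≤ C) (hy : 0 < y) (hpos : ∀ t ∈ Ioi (0 : ℝ), 0 < f t) :
    0 < laplace f y := by
  refine (setIntegral_pos_iff_support_of_nonneg_ae ?_
    (integrableOn_exp_neg_mul_of_bound hf hC hy)).2 ?_
  · exact (ae_restrict_iff' measurableSet_Ioi).2
      (ae_of_all _ fun t ht => (mul_pos (Real.exp_pos _) (hpos t ht)).le)
  · have : Ioi (0 : ℝ) ⊆ (Function.support fun t => Real.exp (-(y * t)) * f t) ∩ Ioi 0 :=
      fun t ht => ⟨(mul_pos (Real.exp_pos _) (hpos t ht)).ne', ht⟩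
    exact lt_of_lt_of_le (by simp) (measure_mono this)

lemma laplace_poissonKernelDeriv_succ (m : ℕ) {y : ℝ} (hy : 0 < y) :
    laplace (poissonKernelDeriv (m + 1)) y =
      y * laplace (poissonKernelDeriv m) y - poissonKernelDeriv m 0 := by
  have hi : ∀ k, IntegrableOn (fun t => Real.exp (-(y * t)) * poissonKernelDeriv k t) (Ioi 0) :=
    fun k => integrableOn_exp_neg_mul_of_bound (continuous_poissonKernelDeriv k).measurable
      (fun t _ => abs_poissonKernelDeriv_le k t) hy
  have hd : ∀ t ∈ Ici (0 : ℝ), HasDerivAt (fun t => Real.exp (-(y * t)) * poissonKernelDeriv m t)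
      (Real.exp (-(y * t)) * poissonKernelDeriv (m + 1) t
        - y * (Real.exp (-(y * t)) * poissonKernelDeriv m t)) t := fun t _ => by
    have h1 : HasDerivAt (fun t => Real.exp (-(y * t))) (Real.exp (-(y * t)) * -(y * 1)) t :=
      ((hasDerivAt_id t).const_mul y).neg.exp
    convert! h1.mul (hasDerivAt_poissonKernelDeriv m t) using 1
    ring
  have hlim : Tendsto (fun t => Real.exp (-(y * t)) * poissonKernelDeriv m t) atTop (𝓝 0) := by
    refine squeeze_zero_norm (a := fun t => Real.exp (-(y * t)) * (m ! : ℝ)) (fun t => ?_) ?_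
    · rw [norm_mul, Real.norm_eq_abs, Real.abs_exp]
      gcongr
      exact abs_poissonKernelDeriv_le m t
    · have : Tendsto (fun t => Real.exp (-(y * t))) atTop (𝓝 0) :=
        Real.tendsto_exp_neg_atTop_nhds_zero.comp (tendsto_id.const_mul_atTop hy)
      simpa using this.mul_const (m ! : ℝ)
  have := integral_Ioi_of_hasDerivAt_of_tendsto' hd ((hi (m + 1)).sub ((hi m).const_mul y)) hlim
  rw [integral_sub (hi (m + 1)) ((hi m).const_mul y), integral_const_mul] at this
  simp only [laplace]
  simp only [mul_zero, neg_zero, Real.exp_zero, one_mul, zero_sub] at this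
  linarith

/-- Each induction step is two integrations by parts; the odd derivatives vanish at 0, so only even
boundary terms survive. -/
lemma laplace_poissonKernelDeriv_zero_eq (p : ℕ) {y : ℝ} (hy : 0 < y) :
    laplace (poissonKernelDeriv 0) y = laplace (poissonKernelDeriv (2 * p)) y / y ^ (2 * p)
      + ∑ j ∈ Finset.range p, (-1) ^ j * ((2 * j)! : ℝ) / y ^ (2 * j + 1) := by
  induction p with
  | zero => simp
  | succ p ih =>
    rw [ih, Finset.sum_range_succ, show 2 * (p + 1) = 2 * p + 1 + 1 by ring,
      laplace_poissonKernelDeriv_succ _ hy, laplace_poissonKernelDeriv_succ _ hy,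
      poissonKernelDeriv_odd_apply_zero, poissonKernelDeriv_even_apply_zero]
    field_simp
    ring

/-! ### Even zeta values and a Fourier series -/

/-- The positive angular frequencies `2 π (k + 1)` of the `1`-periodic functions. -/
noncomputable def angularFreq (k : ℕ) : ℝ := 2 * Real.pi * ((k + 1 : ℕ) : ℝ)

lemma angularFreq_pos (k : ℕ) : 0 < angularFreq k := by
  unfold angularFreq; positivity

lemma cos_angularFreq (k : ℕ) : Real.cos (angularFreq k) = 1 := by
  rw [angularFreq, mul_comm, Real.cos_nat_mul_two_pi]

lemma sin_angularFreq (k : ℕ) : Real.sin (angularFreq k) = 0 := by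
  rw [angularFreq, show 2 * Real.pi * ((k + 1 : ℕ) : ℝ) = ((2 * (k + 1) : ℕ) : ℝ) * Real.pi by
    push_cast; ring, Real.sin_nat_mul_pi]

lemma hasSum_one_div_angularFreq_pow {j : ℕ} (hj : j ≠ 0) :
    HasSum (fun k => 2 / angularFreq k ^ (2 * j))
      ((-1) ^ (j + 1) * (bernoulli (2 * j) : ℝ) / ((2 * j)! : ℝ)) := by
  -- The index is shifted by one; the dropped term at 0 is 1/0^(2j) = 0.
  have h := (hasSum_nat_add_iff' 1).2 (hasSum_zeta_nat hj)
  have h2 := h.mul_left (2 / (2 * Real.pi) ^ (2 * j))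
  convert! h2 using 1
  · ext k
    rw [angularFreq, mul_pow]
    field_simp
  · have : (2 : ℝ) ^ (2 * j) = 2 * 2 ^ (2 * j - 1) := by
      rw [← pow_succ', Nat.sub_add_cancel (by omega)]
    rw [mul_pow, this]
    simp [hj]
    field_simp

lemma summable_one_div_angularFreq_pow {j : ℕ} (hj : j ≠ 0) :
    Summable fun k => 2 / angularFreq k ^ (2 * j) :=
  (hasSum_one_div_angularFreq_pow hj).summable

/-- Subtract the Fourier series of the second Bernoulli polynomial at u from its value at 0. -/
lemma hasSum_one_sub_cos_angularFreq {u : ℝ} (hu : u ∈ Icc (0 : ℝ) 1) :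
    HasSum (fun k => 2 / angularFreq k ^ 2 * (1 - Real.cos (angularFreq k * u)))
      (1 / 2 * (u * (1 - u))) := by
  have h0 := hasSum_one_div_nat_pow_mul_cos one_ne_zero (left_mem_Icc.mpr zero_le_one)
  have h1 := hasSum_one_div_nat_pow_mul_cos one_ne_zero hu
  have hB : ∀ x : ℝ, (Polynomial.map (algebraMap ℚ ℝ) (Polynomial.bernoulli (2 * 1))).eval x
      = x ^ 2 - x + 6⁻¹ := fun x => bernoulliFun_two x
  rw [hB] at h0 h1
  have h := ((hasSum_nat_add_iff' 1).2 (h0.sub h1)).mul_left (2 / (2 * Real.pi) ^ 2)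
  convert! h using 1
  · ext k
    rw [angularFreq]
    simp only [mul_zero, Real.cos_zero, mul_one]
    field_simp
  · simp
    field_simp
    ring

/-! ### The difference equation for the Laplace series -/

lemma laplace_mul_left (f : ℝ → ℝ) {a : ℝ} (ha : 0 < a) (x : ℝ) :
    laplace f (a * x) = a⁻¹ * laplace (fun t => f (t / a)) x := by
  have := integral_comp_mul_left_Ioi (fun s => Real.exp (-(x * s)) * f (s / a)) 0 ha
  rw [mul_zero, smul_eq_mul] at this
  rw [laplace, laplace, ← this]
  congr 1
  ext t
  rw [mul_div_cancel_left₀ _ ha.ne', mul_left_comm, mul_assoc]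

lemma integral_one_sub_cos_mul_exp (k : ℕ) {t : ℝ} (ht : 0 < t) :
    ∫ u in (0 : ℝ)..1, (1 - Real.cos (angularFreq k * u)) * Real.exp (-(u * t))
      = (1 - Real.exp (-t)) * angularFreq k ^ 2 / (t * (t ^ 2 + angularFreq k ^ 2)) := by
  set a := angularFreq k with ha
  have ha0 : 0 < a := angularFreq_pos k
  have hden : t ^ 2 + a ^ 2 ≠ 0 := by positivity
  have hd : ∀ u ∈ uIcc (0 : ℝ) 1, HasDerivAt
      (fun u => -Real.exp (-(u * t)) * (1 / t
        + (a * Real.sin (a * u) - t * Real.cos (a * u)) / (t ^ 2 + a ^ 2)))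
      ((1 - Real.cos (a * u)) * Real.exp (-(u * t))) u := fun u _ => by
    have he : HasDerivAt (fun u => Real.exp (-(u * t))) (Real.exp (-(u * t)) * -(1 * t)) u :=
      ((hasDerivAt_id u).mul_const t).neg.exp
    have hau : HasDerivAt (fun u => a * u) (a * 1) u := (hasDerivAt_id u).const_mul a
    have hs := hau.sin
    have hc := hau.cos
    have := he.neg.mul (((((hs.const_mul a).sub (hc.const_mul t))).div_const
      (t ^ 2 + a ^ 2)).const_add (1 / t))
    convert! this using 1
    simp only [Pi.neg_apply, Pi.sub_apply]
    field_simp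
    ring
  rw [intervalIntegral.integral_eq_sub_of_hasDerivAt hd
    (Continuous.intervalIntegrable (by fun_prop) _ _)]
  simp only [mul_one, mul_zero, zero_mul, neg_zero, Real.exp_zero, Real.cos_zero, Real.sin_zero,
    one_mul, ha, cos_angularFreq, sin_angularFreq]
  rw [← ha]
  field_simp
  ring

lemma integral_mul_exp_neg_mul_Ioi {y : ℝ} (hy : 0 < y) :
    ∫ t in Ioi (0 : ℝ), t * Real.exp (-(y * t)) = 1 / y ^ 2 := by
  have := Real.integral_rpow_mul_exp_neg_mul_Ioi (a := 2) two_pos hy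
  norm_num at this
  simpa using this

lemma integrableOn_mul_exp_neg_mul_Ioi {y : ℝ} (hy : 0 < y) :
    IntegrableOn (fun t => t * Real.exp (-(y * t))) (Ioi 0) :=
  -- A non-integrable function would have integral 0 by convention.
  .of_integral_ne_zero (by rw [integral_mul_exp_neg_mul_Ioi hy]; positivity)

lemma laplace_poissonKernelDeriv_zero_mul_angularFreq (k : ℕ) (x : ℝ) :
    2 / angularFreq k * laplace (poissonKernelDeriv 0) (angularFreq k * x)
      = 2 / angularFreq k ^ 2 * laplace (fun t => poissonKernelDeriv 0 (t / angularFreq k)) x := by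
  rw [laplace_mul_left _ (angularFreq_pos k)]
  have := (angularFreq_pos k).ne'
  field_simp

/-- The factor (1 - e^(-t))/(1 + t²/a²) equals t ∫₀¹ (1 - cos(au)) e^(-ut) du; Fubini then leaves ∫
t e^(-(x+u)t) dt = 1/(x+u)². -/
lemma laplace_poissonKernelDeriv_sub_add_one (k : ℕ) {x : ℝ} (hx : 0 < x) :
    2 / angularFreq k * laplace (poissonKernelDeriv 0) (angularFreq k * x)
      - 2 / angularFreq k * laplace (poissonKernelDeriv 0) (angularFreq k * (x + 1))
      = ∫ u in (0 : ℝ)..1,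
          2 / angularFreq k ^ 2 * (1 - Real.cos (angularFreq k * u)) * (1 / (x + u) ^ 2) := by
  simp_rw [laplace_poissonKernelDeriv_zero_mul_angularFreq, mul_assoc]
  rw [intervalIntegral.integral_const_mul, ← mul_sub]
  congr 1
  set a := angularFreq k with ha
  have ha0 : 0 < a := angularFreq_pos k
  have hi : ∀ y : ℝ, 0 < y →
      IntegrableOn (fun t => Real.exp (-(y * t)) * poissonKernelDeriv 0 (t / a)) (Ioi 0) :=
    fun y hy => integrableOn_exp_neg_mul_of_bound
      ((continuous_poissonKernelDeriv 0).comp (continuous_id.div_const a)).measurable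
      (fun t _ => abs_poissonKernelDeriv_le 0 _) hy
  rw [laplace, laplace, ← integral_sub (hi x hx) (hi (x + 1) (by linarith))]
  have hswap := integral_integral_swap (μ := volume.restrict (Ioi (0 : ℝ)))
    (ν := volume.restrict (Ioc (0 : ℝ) 1))
    (f := fun t u => t * Real.exp (-(x * t)) * ((1 - Real.cos (a * u)) * Real.exp (-(u * t)))) ?_
  · calc ∫ t in Ioi (0 : ℝ), (Real.exp (-(x * t)) * poissonKernelDeriv 0 (t / a)
          - Real.exp (-((x + 1) * t)) * poissonKernelDeriv 0 (t / a))
        = ∫ t in Ioi (0 : ℝ), ∫ u in Ioc (0 : ℝ) 1,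
            t * Real.exp (-(x * t)) * ((1 - Real.cos (a * u)) * Real.exp (-(u * t))) := by
          refine setIntegral_congr_fun measurableSet_Ioi fun t ht => ?_
          have ht' : (0 : ℝ) < t := ht
          rw [integral_const_mul, ← intervalIntegral.integral_of_le zero_le_one,
            integral_one_sub_cos_mul_exp k ht', ← ha, poissonKernelDeriv_zero,
            show -((x + 1) * t) = -(x * t) + -t by ring, Real.exp_add]
          field_simp
          ring
      _ = ∫ u in Ioc (0 : ℝ) 1, ∫ t in Ioi (0 : ℝ),
            t * Real.exp (-(x * t)) * ((1 - Real.cos (a * u)) * Real.exp (-(u * t))) := hswap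
      _ = ∫ u in (0 : ℝ)..1, (1 - Real.cos (a * u)) * (1 / (x + u) ^ 2) := by
          rw [intervalIntegral.integral_of_le zero_le_one]
          refine setIntegral_congr_fun measurableSet_Ioc fun u hu => ?_
          rw [← integral_mul_exp_neg_mul_Ioi (add_pos hx hu.1), ← integral_const_mul]
          congr 1
          ext t
          rw [show -((x + u) * t) = -(x * t) + -(u * t) by ring, Real.exp_add]
          ring
  -- The integrand is dominated by 2t e^(-xt).
  · have hb := (integrableOn_mul_exp_neg_mul_Ioi hx).mul_prod
      (integrable_const (μ := volume.restrict (Ioc (0 : ℝ) 1)) (2 : ℝ))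
    refine Integrable.mono' hb (Continuous.aestronglyMeasurable (by fun_prop)) ?_
    rw [Measure.prod_restrict]
    refine (ae_restrict_iff' (measurableSet_Ioi.prod measurableSet_Ioc)).2 (ae_of_all _ ?_)
    rintro ⟨t, u⟩ ⟨ht, hu⟩
    have ht' : (0 : ℝ) < t := ht
    simp only [Function.uncurry_apply_pair, norm_mul, Real.norm_eq_abs, Real.abs_exp, abs_of_pos ht']
    have h1 : |1 - Real.cos (a * u)| ≤ 2 := by
      rw [abs_le]; constructor <;> linarith [Real.neg_one_le_cos (a * u), Real.cos_le_one (a * u)]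
    have h2 : Real.exp (-(u * t)) ≤ 1 := Real.exp_le_one_iff.2 (by nlinarith [hu.1])
    have : |1 - Real.cos (a * u)| * Real.exp (-(u * t)) ≤ 2 * 1 :=
      mul_le_mul h1 h2 (Real.exp_pos _).le zero_le_two
    rw [mul_one] at this
    gcongr

lemma integral_mul_one_sub_div_sq {x : ℝ} (hx : 0 < x) :
    ∫ u in (0 : ℝ)..1, 1 / 2 * (u * (1 - u)) * (1 / (x + u) ^ 2)
      = (x + 1 / 2) * (Real.log (x + 1) - Real.log x) - 1 := by
  have hd : ∀ u ∈ uIcc (0 : ℝ) 1, HasDerivAt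
      (fun u => 1 / 2 * (-u + (1 + 2 * x) * Real.log (x + u) + x * (1 + x) * (x + u)⁻¹))
      (1 / 2 * (u * (1 - u)) * (1 / (x + u) ^ 2)) u := fun u hu => by
    rw [uIcc_of_le zero_le_one] at hu
    have hxu : x + u ≠ 0 := by linarith [hu.1]
    have h1 : HasDerivAt (fun u => x + u) 1 u := (hasDerivAt_id u).const_add x
    have := ((((hasDerivAt_id u).neg).add ((h1.log hxu).const_mul (1 + 2 * x))).add
      ((h1.inv hxu).const_mul (x * (1 + x)))).const_mul (1 / 2)
    convert! this using 1
    field_simp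
    ring
  rw [intervalIntegral.integral_eq_sub_of_hasDerivAt hd]
  · have : x + 1 ≠ 0 := by positivity
    simp only [add_zero]
    field_simp
    ring
  · refine ContinuousOn.intervalIntegrable ?_
    rw [uIcc_of_le zero_le_one]
    refine ContinuousOn.mul (by fun_prop) (ContinuousOn.div (by fun_prop) (by fun_prop) ?_)
    intro u hu
    have : 0 < x + u := by linarith [hu.1]
    positivity

/-- Under the integral the cosine series sums to u(1-u)/2; dominated convergence applies with the
summable bound 4/(a_k² x²). -/
lemma hasSum_laplace_poissonKernelDeriv_sub_add_one {x : ℝ} (hx : 0 < x) :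
    HasSum (fun k =>
      2 / angularFreq k * laplace (poissonKernelDeriv 0) (angularFreq k * x)
      - 2 / angularFreq k * laplace (poissonKernelDeriv 0) (angularFreq k * (x + 1)))
      ((x + 1 / 2) * (Real.log (x + 1) - Real.log x) - 1) := by
  simp_rw [fun k => laplace_poissonKernelDeriv_sub_add_one k hx]
  rw [← integral_mul_one_sub_div_sq hx]
  have hs : Summable fun k => 2 / angularFreq k ^ 2 * 2 * (1 / x ^ 2) :=
    ((summable_one_div_angularFreq_pow one_ne_zero).mul_right 2).mul_right _
  refine intervalIntegral.hasSum_integral_of_dominated_convergence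
    (fun k _ => 2 / angularFreq k ^ 2 * 2 * (1 / x ^ 2)) (fun k => ?_) (fun k => ?_)
    (ae_of_all _ fun _ _ => hs) intervalIntegrable_const (ae_of_all _ fun u hu => ?_)
  · exact Measurable.aestronglyMeasurable (by fun_prop)
  · refine ae_of_all _ fun u hu => ?_
    rw [uIoc_of_le zero_le_one] at hu
    have h1 : |1 - Real.cos (angularFreq k * u)| ≤ 2 := by
      rw [abs_le]
      constructor <;>
        linarith [Real.neg_one_le_cos (angularFreq k * u), Real.cos_le_one (angularFreq k * u)]
    have h2 : x ≤ x + u := by linarith [hu.1]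
    rw [norm_mul, norm_mul, Real.norm_of_nonneg (by positivity : 0 ≤ 2 / angularFreq k ^ 2),
      Real.norm_of_nonneg (by positivity : 0 ≤ 1 / (x + u) ^ 2), Real.norm_eq_abs]
    gcongr
  · rw [uIoc_of_le zero_le_one] at hu
    exact (hasSum_one_sub_cos_angularFreq ⟨hu.1.le, hu.2⟩).mul_right _

lemma laplace_poissonKernelDeriv_term_bounds (k : ℕ) {x : ℝ} (hx : 0 < x) :
    0 ≤ 2 / angularFreq k * laplace (poissonKernelDeriv 0) (angularFreq k * x) ∧
      2 / angularFreq k * laplace (poissonKernelDeriv 0) (angularFreq k * x)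
        ≤ 2 / angularFreq k ^ 2 * (1 / x) := by
  have ha := angularFreq_pos k
  constructor
  · refine mul_nonneg (by positivity) (laplace_nonneg fun t _ => ?_)
    rw [poissonKernelDeriv_zero]
    positivity
  · have := laplace_le_of_bound (continuous_poissonKernelDeriv 0).measurable
      (fun t _ => abs_poissonKernelDeriv_le 0 t) (mul_pos ha hx)
    calc _ ≤ 2 / angularFreq k * ((0 ! : ℕ) / (angularFreq k * x)) := by gcongr
      _ = _ := by simp; field_simp

lemma summable_laplace_poissonKernelDeriv {x : ℝ} (hx : 0 < x) :
    Summable fun k => 2 / angularFreq k * laplace (poissonKernelDeriv 0) (angularFreq k * x) :=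
  .of_nonneg_of_le (fun k => (laplace_poissonKernelDeriv_term_bounds k hx).1)
    (fun k => (laplace_poissonKernelDeriv_term_bounds k hx).2)
    ((summable_one_div_angularFreq_pow one_ne_zero).mul_right _)

/-! ### Stirling's remainder and Binet's formula -/

lemma logGammaRemainder_zero_eq (x : ℝ) : logGammaRemainder 0 x =
    Real.log (Real.Gamma x) - (x - 1 / 2) * Real.log x + x - 1 / 2 * Real.log (2 * Real.pi) := by
  simp [logGammaRemainder]

lemma logGammaRemainder_zero_sub_add_one {x : ℝ} (hx : 0 < x) :
    logGammaRemainder 0 x - logGammaRemainder 0 (x + 1)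
      = (x + 1 / 2) * (Real.log (x + 1) - Real.log x) - 1 := by
  rw [logGammaRemainder_zero_eq, logGammaRemainder_zero_eq, Real.Gamma_add_one hx.ne',
    Real.log_mul hx.ne' (Real.Gamma_pos_of_pos hx).ne']
  ring

lemma log_Gamma_add_nat {x : ℝ} (hx : 0 < x) (n : ℕ) :
    Real.log (Real.Gamma (x + n))
      = Real.log (Real.Gamma x) + ∑ m ∈ Finset.range n, Real.log (x + m) := by
  induction n with
  | zero => simp
  | succ n ih =>
    have : 0 < x + n := by positivity
    rw [Nat.cast_succ, ← add_assoc, Real.Gamma_add_one this.ne',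
      Real.log_mul this.ne' (Real.Gamma_pos_of_pos this).ne', ih, Finset.sum_range_succ]
    ring

/-- An exact identity expresses this through Euler's limit for log Γ(x), Stirling's formula for n!,
and log(1 + (x+1)/n). The shift n + 1 matches the n + 1 factors in `logGammaSeq`. -/
lemma tendsto_logGammaRemainder_zero_add_nat {x : ℝ} (hx : 0 < x) :
    Tendsto (fun n : ℕ => logGammaRemainder 0 (x + (n + 1 : ℕ))) atTop (𝓝 0) := by
  have hA := (Real.BohrMollerup.tendsto_log_gamma hx).const_sub (Real.log (Real.Gamma x))
  have hB := ((Real.continuousAt_log (Real.sqrt_ne_zero'.2 Real.pi_pos)).tendsto.comp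
    Stirling.tendsto_stirlingSeq_sqrt_pi).sub_const (Real.log √Real.pi)
  have hC := (Real.tendsto_mul_log_one_add_div_atTop (x + 1)).comp
    (tendsto_natCast_atTop_atTop (R := ℝ))
  have hD : Tendsto (fun n : ℕ => Real.log (1 + (x + 1) / (n : ℝ))) atTop (𝓝 0) := by
    have h : Tendsto (fun n : ℕ => 1 + (x + 1) / (n : ℝ)) atTop (𝓝 (1 + 0)) :=
      ((tendsto_const_div_atTop_nhds_zero_nat (x + 1))).const_add 1
    have := (Real.continuousAt_log (by norm_num : (1 + 0 : ℝ) ≠ 0)).tendsto.comp h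
    rwa [add_zero, Real.log_one] at this
  have h := ((hA.add hB).sub (hC.add (hD.const_mul (x + 1 / 2)))).add_const (x + 1)
  have hlim : Real.log (Real.Gamma x) - Real.log (Real.Gamma x)
      + (Real.log √Real.pi - Real.log √Real.pi)
      - (x + 1 + (x + 1 / 2) * 0) + (x + 1) = 0 := by ring
  rw [hlim] at h
  refine h.congr' ?_
  filter_upwards [eventually_gt_atTop 0] with n hn
  have hn' : (0 : ℝ) < n := by exact_mod_cast hn
  have h1 : 1 + (x + 1) / (n : ℝ) = (x + (n + 1)) / n := by field_simp; ring
  have hS := Stirling.log_stirlingSeq_formula n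
  rw [Real.log_div hn'.ne' (Real.exp_ne_zero 1), Real.log_exp,
    Real.log_mul two_ne_zero hn'.ne'] at hS
  simp only [Function.comp_apply]
  rw [h1, Real.log_div (by positivity) hn'.ne', logGammaRemainder_zero_eq,
    log_Gamma_add_nat hx (n + 1), Real.BohrMollerup.logGammaSeq, hS, Real.log_sqrt Real.pi_pos.le,
    Real.log_mul two_ne_zero Real.pi_pos.ne']
  push_cast
  ring

/-- Binet's formula: the remainder in Stirling's formula as a series of Laplace transforms. -/
theorem hasSum_logGammaRemainder_zero {x : ℝ} (hx : 0 < x) :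
    HasSum (fun k => 2 / angularFreq k * laplace (poissonKernelDeriv 0) (angularFreq k * x))
      (logGammaRemainder 0 x) := by
  set F : ℝ → ℝ := fun x =>
    ∑' k, 2 / angularFreq k * laplace (poissonKernelDeriv 0) (angularFreq k * x) with hF
  -- The difference of the two sides is 1-periodic and tends to 0 along x + n, so it is 0.
  have hstep : ∀ y : ℝ, 0 < y →
      F (y + 1) - logGammaRemainder 0 (y + 1) = F y - logGammaRemainder 0 y := fun y hy => by
    have h1 := (((summable_laplace_poissonKernelDeriv hy).hasSum.sub
      (summable_laplace_poissonKernelDeriv (by linarith : 0 < y + 1)).hasSum)).unique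
      (hasSum_laplace_poissonKernelDeriv_sub_add_one hy)
    have h2 := logGammaRemainder_zero_sub_add_one hy
    simp only [hF]
    linarith
  have hper : ∀ n : ℕ, F (x + n) - logGammaRemainder 0 (x + n) = F x - logGammaRemainder 0 x := by
    intro n
    induction n with
    | zero => simp
    | succ n ih => rw [Nat.cast_succ, ← add_assoc, hstep _ (by positivity), ih]
  have hFlim : Tendsto (fun n : ℕ => F (x + (n + 1 : ℕ))) atTop (𝓝 0) := by
    have hy : ∀ n : ℕ, 0 < x + (n + 1 : ℕ) := fun n => by positivity
    refine squeeze_zero (g := fun n : ℕ => (∑' k, 2 / angularFreq k ^ 2) * (1 / (x + (n + 1 : ℕ))))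
      (fun n => tsum_nonneg fun k => (laplace_poissonKernelDeriv_term_bounds k (hy n)).1)
      (fun n => ?_) ?_
    · rw [← tsum_mul_right]
      exact (summable_laplace_poissonKernelDeriv (hy n)).tsum_le_tsum
        (fun k => (laplace_poissonKernelDeriv_term_bounds k (hy n)).2)
        ((summable_one_div_angularFreq_pow one_ne_zero).mul_right _)
    · have : Tendsto (fun n : ℕ => x + (n + 1 : ℕ)) atTop atTop :=
        tendsto_atTop_add_const_left _ _
          (tendsto_natCast_atTop_atTop.comp (tendsto_add_atTop_nat 1))
      simpa using ((tendsto_const_nhds (x := (1 : ℝ))).div_atTop this).const_mul (∑' k, 2 / angularFreq k ^ 2)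
  have hlim := hFlim.sub (tendsto_logGammaRemainder_zero_add_nat hx)
  simp_rw [hper] at hlim
  have : F x - logGammaRemainder 0 x = 0 - 0 := tendsto_nhds_unique tendsto_const_nhds hlim
  rw [show logGammaRemainder 0 x = F x by linarith]
  exact (summable_laplace_poissonKernelDeriv hx).hasSum

/-! ### The remainder as the Laplace transform of a positive density -/

/-- The nonnegative function `(2p)! - (-1) ^ p * D ^ (2p) (1 / (1 + s ^ 2))`. -/
noncomputable def remainderKernel (p : ℕ) (s : ℝ) : ℝ :=
  ((2 * p)! : ℝ) - (-1) ^ p * poissonKernelDeriv (2 * p) s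

/-- The density whose Laplace transform is `x ^ (2p) * R_{p+1}(x)`. -/
noncomputable def remainderDensity (p : ℕ) (t : ℝ) : ℝ :=
  ∑' k, 2 / angularFreq k ^ (2 * (p + 1)) * remainderKernel p (t / angularFreq k)

lemma continuous_remainderKernel (p : ℕ) : Continuous (remainderKernel p) :=
  continuous_const.sub (continuous_const.mul (continuous_poissonKernelDeriv _))

lemma abs_neg_one_pow_mul_poissonKernelDeriv (p : ℕ) (s : ℝ) :
    |(-1) ^ p * poissonKernelDeriv (2 * p) s| = |poissonKernelDeriv (2 * p) s| := by
  simp [abs_mul]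

lemma remainderKernel_nonneg (p : ℕ) (s : ℝ) : 0 ≤ remainderKernel p s :=
  sub_nonneg.2 ((le_abs_self _).trans
    (abs_neg_one_pow_mul_poissonKernelDeriv p s ▸ abs_poissonKernelDeriv_le _ s))

lemma remainderKernel_pos (p : ℕ) {s : ℝ} (hs : 0 < s) : 0 < remainderKernel p s :=
  sub_pos.2 ((le_abs_self _).trans_lt
    (abs_neg_one_pow_mul_poissonKernelDeriv p s ▸ abs_poissonKernelDeriv_lt _ hs))

lemma abs_remainderKernel_le (p : ℕ) (s : ℝ) : |remainderKernel p s| ≤ 2 * ((2 * p)! : ℝ) := by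
  have := abs_poissonKernelDeriv_le (2 * p) s
  rw [← abs_neg_one_pow_mul_poissonKernelDeriv] at this
  rw [abs_of_nonneg (remainderKernel_nonneg p s), remainderKernel]
  linarith [neg_abs_le ((-1) ^ p * poissonKernelDeriv (2 * p) s)]

/-- The term j = p of the expansion is itself y^(-2p) L[(2p)!], so it merges with the remainder
integral into a transform of fixed sign. -/
lemma laplace_remainderKernel_div_pow (p : ℕ) {y : ℝ} (hy : 0 < y) :
    laplace (remainderKernel p) y / y ^ (2 * p) =
      (-1) ^ (p + 1) * (laplace (poissonKernelDeriv 0) y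
        - ∑ j ∈ Finset.range (p + 1), (-1) ^ j * ((2 * j)! : ℝ) / y ^ (2 * j + 1)) := by
  have h : laplace (remainderKernel p) y
      = ((2 * p)! : ℝ) / y - (-1) ^ p * laplace (poissonKernelDeriv (2 * p)) y := by
    have hi := integrableOn_exp_neg_mul_of_bound (continuous_poissonKernelDeriv (2 * p)).measurable
      (fun t _ => abs_poissonKernelDeriv_le (2 * p) t) hy
    have := integral_sub ((integrableOn_exp_neg_mul_Ioi hy).mul_const ((2 * p)! : ℝ))
      (hi.const_mul ((-1) ^ p))
    rw [integral_mul_const, integral_const_mul, integral_exp_neg_mul_Ioi_zero hy] at this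
    rw [laplace, laplace, div_eq_mul_one_div, mul_comm ((2 * p)! : ℝ), ← this]
    congr 1
    ext t
    simp only [remainderKernel]
    ring
  have hp : ((-1 : ℝ) ^ p) * (-1) ^ p = 1 := by rw [← mul_pow]; simp
  rw [h, laplace_poissonKernelDeriv_zero_eq p hy, Finset.sum_range_succ, pow_succ (-1 : ℝ) p]
  have : y ^ (2 * p + 1) = y ^ (2 * p) * y := pow_succ _ _
  rw [this]
  field_simp
  linear_combination (-((2 * p)! : ℝ)) * hp

lemma sum_Icc_one_eq_sum_range (f : ℕ → ℝ) (n : ℕ) :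
    ∑ k ∈ Finset.Icc 1 n, f k = ∑ j ∈ Finset.range n, f (j + 1) := by
  induction n with
  | zero => simp
  | succ n ih => rw [Finset.sum_Icc_succ_top (by omega), ih, Finset.sum_range_succ]

/-- Summed over the frequencies, the boundary terms give even zeta values, hence Bernoulli numbers.
-/
lemma hasSum_asymptotic_term (j : ℕ) (x : ℝ) :
    HasSum (fun k => 2 / angularFreq k
        * ((-1) ^ j * ((2 * j)! : ℝ) / (angularFreq k * x) ^ (2 * j + 1)))
      ((bernoulli (2 * (j + 1)) : ℝ) / (2 * ((j + 1 : ℕ) : ℝ) * (2 * ((j + 1 : ℕ) : ℝ) - 1))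
        * (1 / x ^ (2 * (j + 1) - 1))) := by
  have h := (hasSum_one_div_angularFreq_pow j.succ_ne_zero).mul_right
    ((-1) ^ j * ((2 * j)! : ℝ) / x ^ (2 * j + 1))
  have hp : ((-1 : ℝ) ^ j) * (-1) ^ j = 1 := by rw [← mul_pow]; simp
  convert! h using 1
  · ext k
    have : angularFreq k ^ (2 * j.succ) = angularFreq k * angularFreq k ^ (2 * j + 1) := by
      rw [← pow_succ']; rfl
    rw [mul_pow, this]
    simp only [div_eq_mul_inv, mul_inv]
    ring
  · have hf : ((2 * j.succ)! : ℝ) = (2 * j + 2) * ((2 * j + 1) * ((2 * j)! : ℝ)) := by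
      rw [show 2 * j.succ = 2 * j + 1 + 1 by omega, Nat.factorial_succ, Nat.factorial_succ]
      push_cast
      ring
    have h0 : ((2 * j)! : ℝ) ≠ 0 := by positivity
    have h1 : 2 * ((j : ℝ) + 1) - 1 ≠ 0 := by
      have : (0 : ℝ) ≤ j := j.cast_nonneg
      intro h
      linarith
    rw [hf, show 2 * (j + 1) - 1 = 2 * j + 1 by omega, Nat.succ_eq_add_one,
      show (-1 : ℝ) ^ (j + 1 + 1) = (-1) ^ j by ring]
    push_cast
    rw [show 2 * ((j : ℝ) + 1) - 1 = 2 * j + 1 by ring,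
      show 2 * ((j : ℝ) + 1) = 2 * j + 2 by ring]
    simp only [div_eq_mul_inv, mul_inv, one_mul]
    have h2 : ((2 * j)! : ℝ)⁻¹ * ((2 * j)! : ℝ) = 1 := inv_mul_cancel₀ h0
    linear_combination (-(bernoulli (2 * (j + 1)) : ℝ) * (2 * (j : ℝ) + 2)⁻¹
      * (2 * (j : ℝ) + 1)⁻¹ * (x ^ (2 * j + 1))⁻¹) * (hp + (-1) ^ j * (-1) ^ j * h2)

lemma hasSum_logGammaRemainder_succ (p : ℕ) {x : ℝ} (hx : 0 < x) :
    HasSum (fun k => 2 / angularFreq k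
        * (laplace (remainderKernel p) (angularFreq k * x) / (angularFreq k * x) ^ (2 * p)))
      (logGammaRemainder (p + 1) x) := by
  have h := ((hasSum_logGammaRemainder_zero hx).sub
    (hasSum_sum fun j (_ : j ∈ Finset.range (p + 1)) => hasSum_asymptotic_term j x)).mul_left
    ((-1) ^ (p + 1))
  convert! h using 1
  · ext k
    rw [laplace_remainderKernel_div_pow p (mul_pos (angularFreq_pos k) hx), ← Finset.mul_sum]
    ring
  · rw [logGammaRemainder, sum_Icc_one_eq_sum_range, logGammaRemainder_zero_eq]

lemma abs_remainderDensity_term_le (p k : ℕ) (t : ℝ) :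
    |2 / angularFreq k ^ (2 * (p + 1)) * remainderKernel p (t / angularFreq k)|
      ≤ 2 / angularFreq k ^ (2 * (p + 1)) * (2 * ((2 * p)! : ℝ)) := by
  have := angularFreq_pos k
  rw [abs_mul, abs_of_pos (by positivity : 0 < 2 / angularFreq k ^ (2 * (p + 1)))]
  gcongr
  exact abs_remainderKernel_le p _

lemma summable_remainderDensity_bound (p : ℕ) :
    Summable fun k => 2 / angularFreq k ^ (2 * (p + 1)) * (2 * ((2 * p)! : ℝ)) :=
  (summable_one_div_angularFreq_pow p.succ_ne_zero).mul_right _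

lemma summable_remainderDensity (p : ℕ) (t : ℝ) :
    Summable fun k => 2 / angularFreq k ^ (2 * (p + 1)) * remainderKernel p (t / angularFreq k) :=
  .of_norm_bounded (summable_remainderDensity_bound p) fun k => abs_remainderDensity_term_le p k t

lemma continuous_remainderDensity (p : ℕ) : Continuous (remainderDensity p) :=
  continuous_tsum
    (fun k => continuous_const.mul
      ((continuous_remainderKernel p).comp (continuous_id.div_const (angularFreq k))))
    (summable_remainderDensity_bound p) fun k t => abs_remainderDensity_term_le p k t

lemma exists_abs_remainderDensity_le (p : ℕ) : ∃ C, ∀ t, |remainderDensity p t| ≤ C :=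
  ⟨∑' k, 2 / angularFreq k ^ (2 * (p + 1)) * (2 * ((2 * p)! : ℝ)),
    fun t => by
      rw [remainderDensity, ← Real.norm_eq_abs]
      exact tsum_of_norm_bounded (summable_remainderDensity_bound p).hasSum
        fun k => abs_remainderDensity_term_le p k t⟩

lemma remainderDensity_pos (p : ℕ) {t : ℝ} (ht : 0 < t) : 0 < remainderDensity p t := by
  have hpos : ∀ k, 0 < 2 / angularFreq k ^ (2 * (p + 1)) * remainderKernel p (t / angularFreq k) :=
    fun k => by
      have := angularFreq_pos k
      exact mul_pos (by positivity) (remainderKernel_pos p (by positivity))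
  exact (summable_remainderDensity p t).tsum_pos (fun k => (hpos k).le) 0 (hpos 0)

theorem pow_mul_logGammaRemainder_succ (p : ℕ) {x : ℝ} (hx : 0 < x) :
    x ^ (2 * p) * logGammaRemainder (p + 1) x = laplace (remainderDensity p) x := by
  have hterm : ∀ k, ∫ t in Ioi (0 : ℝ), Real.exp (-(x * t))
      * (2 / angularFreq k ^ (2 * (p + 1)) * remainderKernel p (t / angularFreq k))
      = x ^ (2 * p) * (2 / angularFreq k
        * (laplace (remainderKernel p) (angularFreq k * x) / (angularFreq k * x) ^ (2 * p))) := by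
    intro k
    have ha := angularFreq_pos k
    rw [laplace_mul_left _ ha, laplace]
    simp_rw [mul_left_comm (Real.exp _)]
    rw [integral_const_mul]
    field_simp
    ring
  have hsum := (hasSum_logGammaRemainder_succ p hx).mul_left (x ^ (2 * p))
  have h := hasSum_integral_of_summable_integral_norm (μ := volume.restrict (Ioi (0 : ℝ)))
    (F := fun k t => Real.exp (-(x * t))
      * (2 / angularFreq k ^ (2 * (p + 1)) * remainderKernel p (t / angularFreq k)))
    (fun k => integrableOn_exp_neg_mul_of_bound (Continuous.measurable <| continuous_const.mul
      ((continuous_remainderKernel p).comp (continuous_id.div_const _)))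
      (fun t _ => abs_remainderDensity_term_le p k t) hx) ?_
  · simp_rw [hterm, tsum_mul_left] at h
    exact hsum.unique h
  -- All terms are nonnegative, so the integrals of the norms form the series already known to
  -- converge.
  · refine hsum.summable.congr fun k => ?_
    rw [← hterm]
    refine integral_congr_ae (ae_of_all _ fun t => ?_)
    have := angularFreq_pos k
    exact (Real.norm_of_nonneg (mul_nonneg (Real.exp_pos _).le
      (mul_nonneg (by positivity) (remainderKernel_nonneg p _)))).symm

/-! ### Complete monotonicity and its dependence on the exponent -/

open ProbabilityTheory in
-- The transform is the moment generating function of -t for the measure with density f. It is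
-- analytic inside its domain, and its k-th derivative integrates (-t)^k e^(-xt), which has sign
-- (-1)^k.
theorem completelyMonotonicOn_laplace {f : ℝ → ℝ} {C : ℝ} (hf : Measurable f)
    (hC : ∀ t ∈ Ioi (0 : ℝ), |f t| ≤ C) (hpos : ∀ t ∈ Ioi (0 : ℝ), 0 ≤ f t) :
    CompletelyMonotonicOn (laplace f) (Ioi 0) := by
  set ν : Measure ℝ := (volume.restrict (Ioi 0)).withDensity fun t => ENNReal.ofReal (f t) with hν
  have hfm : Measurable fun t => ENNReal.ofReal (f t) := hf.ennreal_ofReal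
  have hfin : ∀ᵐ t ∂volume.restrict (Ioi (0 : ℝ)), ENNReal.ofReal (f t) < ⊤ :=
    ae_of_all _ fun _ => ENNReal.ofReal_lt_top
  have hlap : laplace f = mgf (fun t : ℝ => -t) ν := by
    ext y
    rw [mgf, hν, integral_withDensity_eq_integral_toReal_smul hfm hfin, laplace]
    refine setIntegral_congr_fun measurableSet_Ioi fun t ht => ?_
    rw [ENNReal.toReal_ofReal (hpos t ht), smul_eq_mul, mul_comm, mul_neg]
  have hint : Ioi (0 : ℝ) ⊆ interior (integrableExpSet (fun t : ℝ => -t) ν) := by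
    refine interior_maximal (fun y hy => ?_) isOpen_Ioi
    change Integrable (fun t => Real.exp (y * -t)) ν
    rw [hν, integrable_withDensity_iff_integrable_smul' hfm hfin]
    refine (integrableOn_congr_fun (fun t ht => ?_) measurableSet_Ioi).1
      (integrableOn_exp_neg_mul_of_bound hf hC hy)
    rw [ENNReal.toReal_ofReal (hpos t ht), smul_eq_mul, mul_comm, mul_neg]
  have hν_pos : ∀ᵐ t ∂ν, 0 < t :=
    (withDensity_absolutelyContinuous _ _).ae_le (ae_restrict_mem measurableSet_Ioi)
  rw [hlap]
  refine ⟨(analyticOnNhd_mgf.mono hint).contDiffOn (uniqueDiffOn_Ioi 0), fun k x hx => ?_⟩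
  rw [iteratedDerivWithin_of_isOpen isOpen_Ioi hx, iteratedDeriv_mgf (hint hx),
    ← integral_const_mul]
  refine integral_nonneg_of_ae ?_
  filter_upwards [hν_pos] with t ht
  have : (-1 : ℝ) ^ k * ((-t) ^ k * Real.exp (x * -t)) = t ^ k * Real.exp (x * -t) := by
    rw [← mul_assoc, ← mul_pow]
    simp
  simp only [Pi.zero_apply, this]
  positivity

theorem CompletelyMonotonicOn.congr {f g : ℝ → ℝ} {I : Set ℝ} (hf : CompletelyMonotonicOn f I)
    (h : EqOn g f I) : CompletelyMonotonicOn g I :=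
  ⟨hf.1.congr h, fun k x hx => by
    rw [iteratedDerivWithin_congr h hx]
    exact hf.2 k x hx⟩

theorem CompletelyMonotonicOn.mul {f g : ℝ → ℝ} {I : Set ℝ} (hI : UniqueDiffOn ℝ I)
    (hf : CompletelyMonotonicOn f I) (hg : CompletelyMonotonicOn g I) :
    CompletelyMonotonicOn (f * g) I := by
  refine ⟨hf.1.mul hg.1, fun k x hx => ?_⟩
  rw [iteratedDerivWithin_mul hx hI ((hf.1 x hx).of_le (by exact_mod_cast le_top))
    ((hg.1 x hx).of_le (by exact_mod_cast le_top)), Finset.mul_sum]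
  refine Finset.sum_nonneg fun i hi => ?_
  have hik : i ≤ k := Nat.lt_succ_iff.1 (Finset.mem_range.1 hi)
  have := mul_nonneg (Nat.cast_nonneg (α := ℝ) (k.choose i))
    (mul_nonneg (hf.2 i x hx) (hg.2 (k - i) x hx))
  convert! this using 1
  have hsign : (-1 : ℝ) ^ k = (-1) ^ i * (-1) ^ (k - i) := by
    rw [← pow_add, Nat.add_sub_cancel' hik]
  rw [hsign]
  ring

lemma contDiffOn_rpow_const_Ioi (r : ℝ) : ContDiffOn ℝ ∞ (fun x : ℝ => x ^ r) (Ioi 0) :=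
  fun _ hx => (Real.contDiffAt_rpow_const_of_ne (ne_of_gt hx)).contDiffWithinAt

lemma iteratedDerivWithin_rpow_const (r : ℝ) (k : ℕ) {x : ℝ} (hx : x ∈ Ioi (0 : ℝ)) :
    iteratedDerivWithin k (fun x : ℝ => x ^ r) (Ioi 0) x
      = (descPochhammer ℝ k).eval r * x ^ (r - k) := by
  rw [iteratedDerivWithin_of_isOpen isOpen_Ioi hx, iteratedDeriv_eq_iterate,
    Real.iter_deriv_rpow_const]

lemma completelyMonotonicOn_rpow_neg {s : ℝ} (hs : 0 < s) :
    CompletelyMonotonicOn (fun x : ℝ => x ^ (-s)) (Ioi 0) := by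
  refine ⟨contDiffOn_rpow_const_Ioi _, fun k x hx => ?_⟩
  rw [iteratedDerivWithin_rpow_const _ _ hx, ← mul_assoc,
    ← ascPochhammer_eval_neg_eq_descPochhammer, neg_neg]
  exact mul_nonneg (ascPochhammer_pos k s hs).le (Real.rpow_nonneg (le_of_lt hx) _)

lemma CompletelyMonotonicOn.rpow_mul_of_le {f : ℝ → ℝ} {r s : ℝ} (hrs : r ≤ s)
    (h : CompletelyMonotonicOn (fun x => x ^ s * f x) (Ioi 0)) :
    CompletelyMonotonicOn (fun x => x ^ r * f x) (Ioi 0) := by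
  rcases hrs.eq_or_lt with rfl | hlt
  · exact h
  · refine ((completelyMonotonicOn_rpow_neg (sub_pos.2 hlt)).mul (uniqueDiffOn_Ioi 0) h).congr
      fun x hx => ?_
    rw [Pi.mul_apply, ← mul_assoc, ← Real.rpow_add hx]
    congr 2
    ring

/-- By Leibniz the derivative is an explicit finite sum in r; this makes the set of admissible
exponents closed. -/
lemma continuous_iteratedDerivWithin_rpow_mul {f : ℝ → ℝ} (hf : ContDiffOn ℝ ∞ f (Ioi 0)) (k : ℕ)
    {x : ℝ} (hx : x ∈ Ioi (0 : ℝ)) :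
    Continuous fun r : ℝ => iteratedDerivWithin k (fun x => x ^ r * f x) (Ioi 0) x := by
  have h : ∀ r : ℝ, iteratedDerivWithin k (fun x => x ^ r * f x) (Ioi 0) x
      = ∑ i ∈ Finset.range (k + 1), (k.choose i : ℝ) *
          ((descPochhammer ℝ i).eval r * x ^ (r - i)) *
          iteratedDerivWithin (k - i) f (Ioi 0) x := fun r => by
    have := iteratedDerivWithin_mul (n := k) hx (uniqueDiffOn_Ioi 0)
      ((contDiffOn_rpow_const_Ioi r x hx).of_le (by exact_mod_cast le_top))
      ((hf x hx).of_le (by exact_mod_cast le_top))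
    simp_rw [iteratedDerivWithin_rpow_const r _ hx] at this
    exact this
  simp_rw [h]
  have hx0 : x ≠ 0 := ne_of_gt hx
  refine continuous_finsetSum _ fun i _ => ?_
  exact (continuous_const.mul ((Polynomial.continuous _).mul
    ((Real.continuous_const_rpow hx0).comp (continuous_id.sub continuous_const)))).mul
    continuous_const

/-- If `x ^ β * f x` is completely monotonic but `x ^ γ * f x` is not, then the completely
monotonic degree of `f` exists and lies in `[β, γ)`. -/
theorem exists_isCMDegree {f : ℝ → ℝ} {β γ : ℝ} (hlim : Tendsto f atTop (𝓝 0)) (hβ : 0 ≤ β)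
    (h : CompletelyMonotonicOn (fun x => x ^ β * f x) (Ioi 0))
    (h' : ¬ CompletelyMonotonicOn (fun x => x ^ γ * f x) (Ioi 0)) :
    ∃ α, IsCMDegree f α ∧ β ≤ α ∧ α < γ := by
  have hf : CompletelyMonotonicOn f (Ioi 0) := by
    simpa using h.rpow_mul_of_le hβ
  set S : Set ℝ := {r | CompletelyMonotonicOn (fun x => x ^ r * f x) (Ioi 0)} with hS
  have hSne : S.Nonempty := ⟨β, h⟩
  have hSlt : ∀ r ∈ S, r < γ := fun r hr => lt_of_not_ge fun hle => h' (hr.rpow_mul_of_le hle)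
  have hSbdd : BddAbove S := ⟨γ, fun r hr => (hSlt r hr).le⟩
  have hSclosed : IsClosed S := by
    -- Smoothness holds for every r, so membership reduces to the sign conditions, each closed in r.
    have : S = ⋂ (k : ℕ) (x : ℝ) (_ : x ∈ Ioi (0 : ℝ)),
        {r | 0 ≤ (-1 : ℝ) ^ k * iteratedDerivWithin k (fun x => x ^ r * f x) (Ioi 0) x} := by
      ext r
      simp only [hS, mem_ofPred_eq, mem_iInter]
      exact ⟨fun hr => hr.2, fun hr => ⟨(contDiffOn_rpow_const_Ioi r).mul hf.1, hr⟩⟩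
    rw [this]
    exact isClosed_iInter fun k => isClosed_iInter fun x => isClosed_iInter fun hx =>
      isClosed_le continuous_const
        (continuous_const.mul (continuous_iteratedDerivWithin_rpow_mul hf.1 k hx))
  have hmem : sSup S ∈ S := hSclosed.csSup_mem hSne hSbdd
  have hβS : β ≤ sSup S := le_csSup hSbdd h
  refine ⟨sSup S, ⟨hf, hβ.trans hβS, 0, hlim, fun r _ => ?_⟩, hβS, hSlt _ hmem⟩
  simp only [sub_zero]
  exact ⟨fun hr => le_csSup hSbdd hr, fun hr => CompletelyMonotonicOn.rpow_mul_of_le hr hmem⟩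

/-! ### Failure of convexity at the exponent 2n - 1 -/

theorem CompletelyMonotonicOn.convexOn {f : ℝ → ℝ} (hf : CompletelyMonotonicOn f (Ioi 0)) :
    ConvexOn ℝ (Ioi 0) f := by
  refine convexOn_of_deriv2_nonneg' (convex_Ioi 0) (hf.1.differentiableOn (by simp)) ?_
    fun x hx => ?_
  · exact (((contDiffOn_infty_iff_deriv_of_isOpen isOpen_Ioi).1 hf.1).2).differentiableOn (by simp)
  · have := hf.2 2 x hx
    rw [iteratedDerivWithin_of_isOpen isOpen_Ioi hx, iteratedDeriv_eq_iterate] at this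
    simpa using this

/-- A positive function that is `O(x ^ 2)` at `0` cannot be concave on `(0, ∞)`. -/
lemma not_convexOn_const_sub {h : ℝ → ℝ} {c C : ℝ} (hpos : ∀ x, 0 < x → 0 < h x)
    (hle : ∀ x, 0 < x → h x ≤ C * x ^ 2) : ¬ ConvexOn ℝ (Ioi 0) fun x => c - h x := by
  intro hconv
  have h1 := hpos 1 one_pos
  have hC : h 1 ≤ C := by simpa using hle 1 one_pos
  have hC0 : 0 < C := h1.trans_le hC
  -- Concavity between τ (standing in for 0, which is outside the domain) and 1 gives a value above
  -- τ h(1) at a point below 2τ, where the quadratic bound allows at most 4Cτ² = τ h(1)/2.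
  set τ := h 1 / (8 * C) with hτ
  have hτ0 : 0 < τ := by positivity
  have hτ1 : τ < 1 := by
    rw [hτ, div_lt_one (by positivity)]
    linarith
  have hτC : 8 * C * τ = h 1 := by rw [hτ]; field_simp
  have hs := hconv.2 (mem_Ioi.2 one_pos) (mem_Ioi.2 hτ0) hτ0.le (sub_nonneg.2 hτ1.le) (by ring)
  simp only [smul_eq_mul, mul_one] at hs
  have hs0 : 0 < τ + (1 - τ) * τ := by nlinarith
  have hb := hle _ hs0
  have h2 : (τ + (1 - τ) * τ) ^ 2 ≤ (2 * τ) ^ 2 := by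
    gcongr
    nlinarith
  have h3 : C * (τ + (1 - τ) * τ) ^ 2 ≤ C * (2 * τ) ^ 2 := by gcongr
  have h4 : 0 < (1 - τ) * h τ := mul_pos (sub_pos.2 hτ1) (hpos τ hτ0)
  have h5 : C * (2 * τ) ^ 2 = τ * h 1 / 2 := by rw [← hτC]; ring
  have h6 : 0 < τ * h 1 := mul_pos hτ0 h1
  nlinarith

/-! ### The two bounds for the remainder -/

lemma exists_laplace_remainderDensity_le (p : ℕ) :
    ∃ C, ∀ x, 0 < x → laplace (remainderDensity p) x ≤ C / x := by
  obtain ⟨C, hC⟩ := exists_abs_remainderDensity_le p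
  exact ⟨C, fun x hx =>
    laplace_le_of_bound (continuous_remainderDensity p).measurable (fun t _ => hC t) hx⟩

lemma logGammaRemainder_succ_pos (p : ℕ) {x : ℝ} (hx : 0 < x) :
    0 < logGammaRemainder (p + 1) x := by
  obtain ⟨C, hC⟩ := exists_abs_remainderDensity_le p
  have h := laplace_pos (continuous_remainderDensity p).measurable (fun t _ => hC t) hx
    fun t ht => remainderDensity_pos p ht
  rw [← pow_mul_logGammaRemainder_succ p hx] at h
  exact pos_of_mul_pos_right h (by positivity)

lemma tendsto_logGammaRemainder_succ (p : ℕ) :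
    Tendsto (logGammaRemainder (p + 1)) atTop (𝓝 0) := by
  obtain ⟨C, hC⟩ := exists_laplace_remainderDensity_le p
  refine squeeze_zero' (g := fun x => C / x) ?_ ?_ (tendsto_const_nhds.div_atTop tendsto_id)
  · filter_upwards [eventually_gt_atTop 0] with x hx using (logGammaRemainder_succ_pos p hx).le
  · filter_upwards [eventually_ge_atTop 1] with x hx
    have hx0 : 0 < x := one_pos.trans_le hx
    refine le_trans ?_ (hC x hx0)
    rw [← pow_mul_logGammaRemainder_succ p hx0]
    exact le_mul_of_one_le_left (logGammaRemainder_succ_pos p hx0).le (one_le_pow₀ hx)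

lemma completelyMonotonicOn_rpow_mul_logGammaRemainder (p : ℕ) :
    CompletelyMonotonicOn (fun x => x ^ (2 * (p : ℝ)) * logGammaRemainder (p + 1) x) (Ioi 0) := by
  obtain ⟨C, hC⟩ := exists_abs_remainderDensity_le p
  refine (completelyMonotonicOn_laplace (continuous_remainderDensity p).measurable
    (fun t _ => hC t) fun t ht => (remainderDensity_pos p ht).le).congr fun x hx => ?_
  rw [← pow_mul_logGammaRemainder_succ p hx, ← Real.rpow_natCast]
  push_cast
  rfl

/-- Consecutive remainders have opposite sign factors and differ by one monomial, which the power of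
x turns into a constant. -/
lemma exists_pow_mul_logGammaRemainder_succ_eq (n : ℕ) : ∃ c : ℝ, ∀ x, 0 < x →
    x ^ (2 * n + 1) * logGammaRemainder (n + 1) x
      = c - x ^ (2 * n + 1) * logGammaRemainder n x := by
  refine ⟨(-1) ^ n * ((bernoulli (2 * (n + 1)) : ℝ)
    / (2 * ((n + 1 : ℕ) : ℝ) * (2 * ((n + 1 : ℕ) : ℝ) - 1))), fun x hx => ?_⟩
  have hp : x ^ (2 * n + 1) * (1 / x ^ (2 * (n + 1) - 1)) = 1 :=
    mul_one_div_cancel (by positivity)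
  rw [logGammaRemainder, logGammaRemainder, Finset.sum_Icc_succ_top (by omega), pow_succ (-1 : ℝ) n]
  linear_combination ((-1) ^ n * ((bernoulli (2 * (n + 1)) : ℝ)
    / (2 * ((n + 1 : ℕ) : ℝ) * (2 * ((n + 1 : ℕ) : ℝ) - 1)))) * hp

lemma not_completelyMonotonicOn_pow_mul_logGammaRemainder (p : ℕ) :
    ¬ CompletelyMonotonicOn (fun x => x ^ (2 * p + 3) * logGammaRemainder (p + 2) x) (Ioi 0) := by
  intro h
  obtain ⟨c, hc⟩ := exists_pow_mul_logGammaRemainder_succ_eq (p + 1)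
  obtain ⟨C, hC⟩ := exists_laplace_remainderDensity_le p
  refine not_convexOn_const_sub (h := fun x => x ^ (2 * p + 3) * logGammaRemainder (p + 1) x)
    (c := c) (C := C) (fun x hx => mul_pos (by positivity) (logGammaRemainder_succ_pos p hx))
    (fun x hx => ?_) (h.convexOn.congr fun x hx => hc x hx)
  -- Here x^(2p) R_{p+1} · x ≤ C, and a factor x² remains.
  have := hC x hx
  rw [← pow_mul_logGammaRemainder_succ p hx, le_div_iff₀ hx] at this
  calc x ^ (2 * p + 3) * logGammaRemainder (p + 1) x
      = x ^ (2 * p) * logGammaRemainder (p + 1) x * x * x ^ 2 := by ring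
    _ ≤ C * x ^ 2 := by gcongr

theorem proposition1 (n : ℕ) (hn : 2 ≤ n) :
    ∃ α : ℝ, IsCMDegree (logGammaRemainder n) α ∧
      2 * ((n : ℝ) - 1) ≤ α ∧ α < 2 * (n : ℝ) - 1 := by
  obtain ⟨p, rfl⟩ := Nat.exists_eq_add_of_le' hn
  refine exists_isCMDegree (tendsto_logGammaRemainder_succ (p + 1)) ?_ ?_ ?_
  · push_cast
    linarith [p.cast_nonneg (α := ℝ)]
  · have := completelyMonotonicOn_rpow_mul_logGammaRemainder (p + 1)
    rwa [show ((p + 1 : ℕ) : ℝ) = ((p + 2 : ℕ) : ℝ) - 1 by push_cast; ring] at this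
  · have := not_completelyMonotonicOn_pow_mul_logGammaRemainder p
    simp_rw [← Real.rpow_natCast] at this
    rwa [show ((2 * p + 3 : ℕ) : ℝ) = 2 * ((p + 2 : ℕ) : ℝ) - 1 by push_cast; ring] at this
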